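/- Theorem (Feuerbach's Magic Triangle). Let $ABC$ be a non-degenerate triangle in the Euclidean plane. Let $A'$ be the reflection of $A$ in the midpoint of $BC$, and define $B'$ and $C'$ similarly as the reflections of $B$ and $C$ in the midpoints of $CA$ and $AB$. Let $\omega_A,\omega_B,\omega_C$ be the incircles, and $\pi_A,\pi_B,\pi_C$ the nine-point circles, of the triangles $A'BC$, $AB'C$, $ABC'$, respectively. Two circles are called internally tangent if one of them touches the other from inside; two coinciding circles count as internally tangent. Then there is exactly one circle $\omega$ that is internally tangent to each of $\omega_A,\omega_B,\omega_C$, and exactly one circle $\pi$ that is internally tangent to each of $\pi_A,\pi_B,\pi_C$; the circles $\omega$ and $\pi$ are tangent to each other (internally or externally). Moreover $\omega$ and $\pi$ can coincide only if $ABC$ is equilateral, so that for every non-equilateral triangle they are two distinct tangent circles. -/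

import Mathlib

/-- The Euclidean plane. -/
abbrev Plane : Type := EuclideanSpace ℝ (Fin 2)

namespace FeuerbachTriangle

open EuclideanGeometry Affine

/-- The vertex `t.points i` reflected in the midpoint of the side opposite to it. -/
noncomputable def reflectedVertex (t : Triangle ℝ Plane) (i : Fin 3) : Plane :=
  AffineEquiv.pointReflection ℝ (midpoint ℝ (t.points (i + 1)) (t.points (i + 2))) (t.points i)

theorem update_reflectedVertex (t : Triangle ℝ Plane) (i : Fin 3) :
    Function.update t.points i (reflectedVertex t i) =
      AffineEquiv.pointReflection ℝ (midpoint ℝ (t.points (i + 1)) (t.points (i + 2))) ∘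
        t.points ∘ Equiv.swap (i + 1) (i + 2) := by
  funext j
  have h : j = i ∨ j = i + 1 ∨ j = i + 2 := by revert i j; decide
  have h01 : i ≠ i + 1 := by simp
  have h02 : i ≠ i + 2 := by simp
  rcases h with rfl | rfl | rfl
  · simp [reflectedVertex, Equiv.swap_apply_of_ne_of_ne h01 h02]
  · simp
  · simp

/-- The triangle obtained from `t` by replacing the vertex number `i` by its reflection in the
midpoint of the opposite side: for `t = ABC` these are `A'BC`, `AB'C`, `ABC'`. -/
noncomputable def reflectedTriangle (t : Triangle ℝ Plane) (i : Fin 3) : Triangle ℝ Plane where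
  points := Function.update t.points i (reflectedVertex t i)
  independent := by
    rw [update_reflectedVertex]
    refine (AffineEquiv.affineIndependent_iff _).2 ?_
    exact (affineIndependent_equiv (Equiv.swap (i + 1) (i + 2))).2 t.independent

/-- Two circles are internally tangent: one of them touches the other from inside. (Mathlib's
`IsIntTangent` is directed: the first sphere lies inside the second.) -/
def InternallyTangent (s₁ s₂ : Sphere Plane) : Prop :=
  s₁.IsIntTangent s₂ ∨ s₂.IsIntTangent s₁

/-- Two circles are tangent, externally or internally. -/
def TangentCircles (s₁ s₂ : Sphere Plane) : Prop :=
  s₁.IsExtTangent s₂ ∨ InternallyTangent s₁ s₂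

/-- `s` is a circle (of positive radius) internally tangent to each of three given circles. -/
def IsCircleIntTangentTo (s : Sphere Plane) (c : Fin 3 → Sphere Plane) : Prop :=
  0 < s.radius ∧ ∀ i, InternallyTangent s (c i)

end FeuerbachTriangle

/-! Write S = A + B + C, and O, I, N for the circumcenter, incenter and nine-point center, R and r
for the circumradius and inradius. The triangle A'BC is the image of ABC under x ↦ S - A - x, so ω_A
has center (S - I) - A and radius r, while π_A has center (S - N) - A and radius R/2; likewise at B
and C. In both families, then, three equal circles of radius ρ ≤ R are centered at the vertices of a
point reflection of ABC. A circle touching all three internally must be concentric with the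
circumcircle of those centers, and its radius is R + ρ (`isCircleIntTangentTo_iff`). Hence ω and π
have centers S - I - O and S - N - O and radii R + r and 3R/2. The centers are IN apart, and
Feuerbach's theorem IN = R/2 - r is exactly tangency. If ω = π then R = 2r, the equality case of
Euler's inequality. -/

namespace Affine.Triangle

open EuclideanGeometry InnerProductGeometry
open scoped RealInnerProductSpace

variable {V P : Type*} [NormedAddCommGroup V] [InnerProductSpace ℝ V] [MetricSpace P]
  [NormedAddTorsor V P]

/-! ### Area, inradius and incenter in terms of the sides -/

theorem sq_height_mul_dist (t : Triangle ℝ P) {i j k : Fin 3} (hij : i ≠ j) (hik : i ≠ k)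
    (hjk : j ≠ k) :
    (t.height i * dist (t.points j) (t.points k)) ^ 2 =
      dist (t.points i) (t.points j) ^ 2 * dist (t.points j) (t.points k) ^ 2 -
        ⟪t.points i -ᵥ t.points j, t.points k -ᵥ t.points j⟫ ^ 2 := by
  have hu := t.inner_vsub_vsub_altitudeFoot_eq_height_sq hij
  have hw := t.inner_vsub_vsub_altitudeFoot_eq_height_sq hik
  have himage : t.points '' {i}ᶜ = {t.points j, t.points k} := by
    rw [show ({i}ᶜ : Set (Fin 3)) = {j, k} by
      ext l
      simp only [Set.mem_compl_iff, Set.mem_singleton_iff, Set.mem_insert_iff]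
      clear hu hw
      decide +revert, Set.image_pair]
  have hF := t.altitudeFoot_mem_affineSpan_image_compl i
  rw [himage, mem_affineSpan_pair_iff_exists_lineMap_eq] at hF
  obtain ⟨c, hc⟩ := hF
  have hh : t.height i ^ 2 = ⟪t.points i -ᵥ t.altitudeFoot i, t.points i -ᵥ t.altitudeFoot i⟫ := by
    rw [Simplex.height, dist_eq_norm_vsub V, real_inner_self_eq_norm_sq]
  rw [dist_comm (t.points j), dist_eq_norm_vsub V (t.points k), dist_eq_norm_vsub V, mul_pow,
    ← real_inner_self_eq_norm_sq, ← real_inner_self_eq_norm_sq]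
  rw [← vsub_sub_vsub_cancel_right _ _ (t.points j)] at hw
  have hfoot : t.points i -ᵥ t.altitudeFoot i =
      (t.points i -ᵥ t.points j) - c • (t.points k -ᵥ t.points j) := by
    rw [← hc, AffineMap.lineMap_apply, vsub_vadd_eq_vsub_sub]
  rw [hfoot] at hu hw hh
  generalize t.points i -ᵥ t.points j = u at *
  generalize t.points k -ᵥ t.points j = v at *
  simp only [inner_sub_left, inner_sub_right, inner_smul_left, inner_smul_right,
    real_inner_comm u v, conj_trivial] at hu hw hh ⊢
  -- `hu` and `hw` both give the squared height; their difference says that the altitude `u - c • v`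
  -- is orthogonal to `v`.
  have huv : ⟪u, v⟫ = c * ⟪v, v⟫ := by linarith
  rw [← hu, huv]
  ring

/-- Heron's formula: height times base is twice the area. -/
theorem four_mul_sq_height_mul_dist (t : Triangle ℝ P) {i j k : Fin 3} (hij : i ≠ j) (hik : i ≠ k)
    (hjk : j ≠ k) :
    4 * (t.height i * dist (t.points j) (t.points k)) ^ 2 =
      4 * dist (t.points i) (t.points j) ^ 2 * dist (t.points j) (t.points k) ^ 2 -
        (dist (t.points i) (t.points j) ^ 2 + dist (t.points j) (t.points k) ^ 2 -
          dist (t.points i) (t.points k) ^ 2) ^ 2 := by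
  rw [t.sq_height_mul_dist hij hik hjk,
    real_inner_eq_norm_mul_self_add_norm_mul_self_sub_norm_sub_mul_self_div_two,
    vsub_sub_vsub_cancel_right, ← dist_eq_norm_vsub, ← dist_eq_norm_vsub, ← dist_eq_norm_vsub,
    dist_comm (t.points k) (t.points j)]
  ring

theorem height_mul_dist_comm (t : Triangle ℝ P) {i j k : Fin 3} (hij : i ≠ j) (hik : i ≠ k)
    (hjk : j ≠ k) :
    t.height i * dist (t.points j) (t.points k) = t.height j * dist (t.points k) (t.points i) := by
  rw [← sq_eq_sq₀ (by positivity) (by positivity)]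
  have h₁ := t.four_mul_sq_height_mul_dist hij hik hjk
  have h₂ := t.four_mul_sq_height_mul_dist hjk hij.symm hik.symm
  rw [dist_comm (t.points j) (t.points i), dist_comm (t.points k) (t.points i)] at h₂
  rw [dist_comm (t.points k) (t.points i)]
  linear_combination (h₁ - h₂) / 4

theorem two_mul_circumradius_mul_height_mul_dist (t : Triangle ℝ P) {i j k : Fin 3} (hij : i ≠ j)
    (hik : i ≠ k) (hjk : j ≠ k) :
    2 * t.circumradius * (t.height i * dist (t.points j) (t.points k)) =
      dist (t.points i) (t.points j) * dist (t.points j) (t.points k) *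
        dist (t.points i) (t.points k) := by
  have hne : ∀ {a b : Fin 3}, a ≠ b → dist (t.points a) (t.points b) ≠ 0 := fun h ↦
    dist_ne_zero.2 (t.independent.injective.ne h)
  have hsin := sin_angle_mul_norm_mul_norm (t.points i -ᵥ t.points j) (t.points k -ᵥ t.points j)
  rw [real_inner_self_eq_norm_sq, real_inner_self_eq_norm_sq, ← dist_eq_norm_vsub,
    ← dist_eq_norm_vsub, dist_comm (t.points k) (t.points j), ← sq ⟪_, _⟫,
    ← t.sq_height_mul_dist hij hik hjk, Real.sqrt_sq (by positivity)] at hsin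
  have hlaw := t.dist_div_sin_angle_eq_two_mul_circumradius hij hik hjk
  rw [EuclideanGeometry.angle] at hlaw
  have hsin0 : Real.sin (angle (t.points i -ᵥ t.points j) (t.points k -ᵥ t.points j)) ≠ 0 := by
    intro h0
    rw [h0, zero_mul] at hsin
    exact mul_ne_zero (t.height_pos i).ne' (hne hjk) hsin.symm
  rw [div_eq_iff hsin0] at hlaw
  rw [hlaw, ← hsin]
  ring

/-- The weights are defined through inverse heights, which are proportional to the sides because all
products of height and base agree. -/
theorem excenterWeights_empty_eq (t : Triangle ℝ P) {i j k : Fin 3} (hij : i ≠ j) (hik : i ≠ k)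
    (hjk : j ≠ k) :
    t.excenterWeights ∅ i = dist (t.points j) (t.points k) / (dist (t.points j) (t.points k) +
      dist (t.points k) (t.points i) + dist (t.points i) (t.points j)) := by
  have hpos : ∀ {a b : Fin 3}, a ≠ b → 0 < dist (t.points a) (t.points b) := fun h ↦
    dist_pos.2 (t.independent.injective.ne h)
  have h₁ := t.height_mul_dist_comm hij hik hjk
  have h₂ := t.height_mul_dist_comm hjk hij.symm hik.symm
  have huniv : (Finset.univ : Finset (Fin 3)) = {i, j, k} := by
    clear h₁ h₂ hpos
    decide +revert
  have hi := t.height_pos i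
  have hj := t.height_pos j
  have hk := t.height_pos k
  have hx := hpos hjk
  have hy := hpos hik.symm
  have hz := hpos hij
  rw [Simplex.excenterWeights, Pi.smul_apply, huniv, Finset.sum_insert (by simp [hij, hik]),
    Finset.sum_pair hjk]
  simp only [Simplex.excenterWeightsUnnorm_empty_apply, smul_eq_mul]
  generalize dist (t.points j) (t.points k) = x at *
  generalize dist (t.points k) (t.points i) = y at *
  generalize dist (t.points i) (t.points j) = z at *
  have ey : t.height j = t.height i * x / y := by rw [eq_div_iff hy.ne', h₁]
  have ez : t.height k = t.height i * x / z := by rw [eq_div_iff hz.ne', h₁, h₂]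
  rw [ey, ez]
  field

theorem inradius_mul_perimeter (t : Triangle ℝ P) {i j k : Fin 3} (hij : i ≠ j) (hik : i ≠ k)
    (hjk : j ≠ k) :
    t.inradius * (dist (t.points j) (t.points k) + dist (t.points k) (t.points i) +
      dist (t.points i) (t.points j)) = t.height i * dist (t.points j) (t.points k) := by
  have hw := t.excenterWeights_empty_eq hij hik hjk
  have hx : 0 < dist (t.points j) (t.points k) := dist_pos.2 (t.independent.injective.ne hjk)
  have hy : 0 ≤ dist (t.points k) (t.points i) := dist_nonneg
  have hz : 0 ≤ dist (t.points i) (t.points j) := dist_nonneg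
  have hs : 0 < ∑ l, t.excenterWeightsUnnorm ∅ l :=
    Finset.sum_pos (fun l _ ↦ by simp) Finset.univ_nonempty
  rw [Simplex.inradius_eq_abs_inv_sum, abs_of_pos (by positivity)]
  rw [Simplex.excenterWeights, Pi.smul_apply, Simplex.excenterWeightsUnnorm_empty_apply,
    smul_eq_mul] at hw
  have hi := t.height_pos i
  field_simp at hw ⊢
  linear_combination hw

theorem incenter_vsub (t : Triangle ℝ P) (p : P) {i j k : Fin 3} (hij : i ≠ j) (hik : i ≠ k)
    (hjk : j ≠ k) :
    (dist (t.points j) (t.points k) + dist (t.points k) (t.points i) +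
      dist (t.points i) (t.points j)) • (t.incenter -ᵥ p) =
      dist (t.points j) (t.points k) • (t.points i -ᵥ p) +
        dist (t.points k) (t.points i) • (t.points j -ᵥ p) +
        dist (t.points i) (t.points j) • (t.points k -ᵥ p) := by
  have hi := t.excenterWeights_empty_eq hij hik hjk
  have hj := t.excenterWeights_empty_eq hjk hij.symm hik.symm
  have hk := t.excenterWeights_empty_eq hik.symm hjk.symm hij
  have hx : 0 < dist (t.points j) (t.points k) := dist_pos.2 (t.independent.injective.ne hjk)
  have hy : 0 ≤ dist (t.points k) (t.points i) := dist_nonneg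
  have hz : 0 ≤ dist (t.points i) (t.points j) := dist_nonneg
  have huniv : (Finset.univ : Finset (Fin 3)) = {i, j, k} := by
    clear hi hj hk hx hy hz
    decide +revert
  rw [Simplex.incenter_eq_affineCombination,
    Finset.affineCombination_eq_weightedVSubOfPoint_vadd_of_sum_eq_one _ _ _
      t.excenterExists_empty.sum_excenterWeights_eq_one p, vadd_vsub,
    Finset.weightedVSubOfPoint_apply, huniv, Finset.sum_insert (by simp [hij, hik]),
    Finset.sum_pair hjk, hi, hj, hk, smul_add, smul_add, smul_smul, smul_smul, smul_smul, add_assoc,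
    mul_div_cancel₀ _ (by positivity), add_assoc (dist _ _ • _)]
  congr 3 <;> field

theorem ninePointCircle_center_vsub_circumcenter (t : Triangle ℝ P) :
    t.ninePointCircle.center -ᵥ t.circumcenter =
      (2⁻¹ : ℝ) • ∑ i, (t.points i -ᵥ t.circumcenter) := by
  rw [Simplex.ninePointCircle_center, vadd_vsub, Simplex.centroid_vsub_eq, smul_smul]
  norm_num

end Affine.Triangle

namespace Affine.Triangle

open EuclideanGeometry
open scoped RealInnerProductSpace

variable {V P : Type*} [NormedAddCommGroup V] [InnerProductSpace ℝ V] [MetricSpace P]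
  [NormedAddTorsor V P]

/-! ### Euler's inequality and Feuerbach's theorem -/

theorem inner_vsub_circumcenter (t : Triangle ℝ P) (i j : Fin 3) :
    ⟪t.points i -ᵥ t.circumcenter, t.points j -ᵥ t.circumcenter⟫ =
      t.circumradius ^ 2 - dist (t.points i) (t.points j) ^ 2 / 2 := by
  rw [real_inner_eq_norm_mul_self_add_norm_mul_self_sub_norm_sub_mul_self_div_two,
    vsub_sub_vsub_cancel_right, ← dist_eq_norm_vsub, ← dist_eq_norm_vsub, ← dist_eq_norm_vsub]
  simp only [Simplex.dist_circumcenter_eq_circumradius]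
  ring

theorem mul_mul_sub_eq (x y z : ℝ) :
    2 * (x * y * z - (y + z - x) * (z + x - y) * (x + y - z)) =
      (y + z - x) * (y - z) ^ 2 + (z + x - y) * (z - x) ^ 2 + (x + y - z) * (x - y) ^ 2 := by
  ring

/-- The circumradius and the inradius in terms of the side lengths. -/
theorem circumradius_sub_two_mul_inradius_mul (t : Triangle ℝ P) {x y z : ℝ}
    (hx : x = dist (t.points 1) (t.points 2)) (hy : y = dist (t.points 2) (t.points 0))
    (hz : z = dist (t.points 0) (t.points 1)) :
    4 * t.inradius * (x + y + z) * (t.circumradius - 2 * t.inradius) =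
      (y + z - x) * (y - z) ^ 2 + (z + x - y) * (z - x) ^ 2 + (x + y - z) * (x - y) ^ 2 := by
  have hpos : 0 < x + y + z := by
    have : 0 < x := hx ▸ dist_pos.2 (t.independent.injective.ne (by decide))
    have : 0 ≤ y := hy ▸ dist_nonneg
    have : 0 ≤ z := hz ▸ dist_nonneg
    positivity
  have hD := t.inradius_mul_perimeter (i := 0) (j := 1) (k := 2) (by decide) (by decide) (by decide)
  have hR := t.two_mul_circumradius_mul_height_mul_dist (i := 0) (j := 1) (k := 2)
    (by decide) (by decide) (by decide)
  have hH := t.four_mul_sq_height_mul_dist (i := 0) (j := 1) (k := 2)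
    (by decide) (by decide) (by decide)
  rw [← hD] at hR hH
  rw [dist_comm (t.points 0) (t.points 2), ← hx, ← hy, ← hz] at hR hH
  rw [← mul_mul_sub_eq]
  -- Heron's product contains the perimeter as a factor, so `hH` applies only after multiplying by
  -- it.
  refine mul_left_cancel₀ hpos.ne' ?_
  linear_combination 2 * (x + y + z) * hR - 2 * hH

theorem two_mul_inradius_le_circumradius (t : Triangle ℝ P) :
    2 * t.inradius ≤ t.circumradius := by
  have h := t.circumradius_sub_two_mul_inradius_mul rfl rfl rfl
  have h₀ := dist_triangle (t.points 1) (t.points 0) (t.points 2)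
  have h₁ := dist_triangle (t.points 2) (t.points 1) (t.points 0)
  have h₂ := dist_triangle (t.points 0) (t.points 2) (t.points 1)
  have hx : 0 < dist (t.points 1) (t.points 2) :=
    dist_pos.2 (t.independent.injective.ne (by decide))
  have hr := t.inradius_pos
  simp only [dist_comm (t.points 1) (t.points 0), dist_comm (t.points 0) (t.points 2),
    dist_comm (t.points 2) (t.points 1)] at h₀ h₁ h₂
  have hy : 0 ≤ dist (t.points 2) (t.points 0) := dist_nonneg
  have hz : 0 ≤ dist (t.points 0) (t.points 1) := dist_nonneg
  generalize dist (t.points 1) (t.points 2) = x at *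
  generalize dist (t.points 2) (t.points 0) = y at *
  generalize dist (t.points 0) (t.points 1) = z at *
  have hx' : 0 ≤ y + z - x := by linarith
  have hy' : 0 ≤ z + x - y := by linarith
  have hz' : 0 ≤ x + y - z := by linarith
  rw [← sub_nonneg]
  refine nonneg_of_mul_nonneg_right (a := 4 * t.inradius * (x + y + z)) ?_ (by positivity)
  rw [h]
  positivity

theorem equilateral_of_circumradius_eq_two_mul_inradius (t : Triangle ℝ P)
    (heq : t.circumradius = 2 * t.inradius) : t.Equilateral := by
  have h := t.circumradius_sub_two_mul_inradius_mul rfl rfl rfl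
  have hH := t.four_mul_sq_height_mul_dist (i := 0) (j := 1) (k := 2)
    (by decide) (by decide) (by decide)
  have h₀ := dist_triangle (t.points 1) (t.points 0) (t.points 2)
  have h₁ := dist_triangle (t.points 2) (t.points 1) (t.points 0)
  have h₂ := dist_triangle (t.points 0) (t.points 2) (t.points 1)
  have hx : 0 < dist (t.points 1) (t.points 2) :=
    dist_pos.2 (t.independent.injective.ne (by decide))
  have hi := t.height_pos 0
  rw [equilateral_iff_dist_01_eq_02_and_dist_01_eq_12]
  simp only [dist_comm (t.points 1) (t.points 0), dist_comm (t.points 0) (t.points 2),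
    dist_comm (t.points 2) (t.points 1)] at h₀ h₁ h₂ hH ⊢
  generalize dist (t.points 1) (t.points 2) = x at *
  generalize dist (t.points 2) (t.points 0) = y at *
  generalize dist (t.points 0) (t.points 1) = z at *
  rw [heq, sub_self, mul_zero] at h
  have hprod : 4 * (t.height 0 * x) ^ 2 =
      (x + y + z) * ((y + z - x) * ((z + x - y) * (x + y - z))) := by
    rw [hH]
    ring
  -- Nonzero area makes the triangle inequalities strict, so each square in `h` must vanish.
  have hne : (x + y + z) * ((y + z - x) * ((z + x - y) * (x + y - z))) ≠ 0 := by
    rw [← hprod]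
    positivity
  simp only [mul_ne_zero_iff] at hne
  obtain ⟨-, hx₀, hy₀, hz₀⟩ := hne
  have hx' : 0 < y + z - x := lt_of_le_of_ne (by linarith) hx₀.symm
  have hy' : 0 < z + x - y := lt_of_le_of_ne (by linarith) hy₀.symm
  have hz' : 0 < x + y - z := lt_of_le_of_ne (by linarith) hz₀.symm
  have e₁ : 0 ≤ (y + z - x) * (y - z) ^ 2 := by positivity
  have e₂ : 0 ≤ (z + x - y) * (z - x) ^ 2 := by positivity
  have e₃ : 0 ≤ (x + y - z) * (x - y) ^ 2 := by positivity
  have f₁ : (y + z - x) * (y - z) ^ 2 = 0 := by linarith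
  have f₂ : (z + x - y) * (z - x) ^ 2 = 0 := by linarith
  simp only [mul_eq_zero, hx'.ne', hy'.ne', false_or, pow_eq_zero_iff, ne_eq, OfNat.ofNat_ne_zero,
    not_false_eq_true, sub_eq_zero] at f₁ f₂
  exact ⟨f₁.symm, f₂⟩

/-- **Feuerbach's theorem**, in terms of the distance between the centers. -/
theorem dist_incenter_ninePointCircle_center (t : Triangle ℝ P) :
    dist t.incenter t.ninePointCircle.center = t.circumradius / 2 - t.inradius := by
  have hle := t.two_mul_inradius_le_circumradius
  have hI := t.incenter_vsub t.circumcenter (i := 0) (j := 1) (k := 2)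
    (by decide) (by decide) (by decide)
  have hN := t.ninePointCircle_center_vsub_circumcenter
  have hpos : 0 < dist (t.points 1) (t.points 2) + dist (t.points 2) (t.points 0) +
      dist (t.points 0) (t.points 1) := by
    have : 0 < dist (t.points 1) (t.points 2) :=
      dist_pos.2 (t.independent.injective.ne (by decide))
    positivity
  have hD := t.inradius_mul_perimeter (i := 0) (j := 1) (k := 2) (by decide) (by decide) (by decide)
  have hR := t.two_mul_circumradius_mul_height_mul_dist (i := 0) (j := 1) (k := 2)
    (by decide) (by decide) (by decide)
  have hH := t.four_mul_sq_height_mul_dist (i := 0) (j := 1) (k := 2)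
    (by decide) (by decide) (by decide)
  have h₀₀ := t.inner_vsub_circumcenter 0 0
  have h₁₁ := t.inner_vsub_circumcenter 1 1
  have h₂₂ := t.inner_vsub_circumcenter 2 2
  have h₀₁ := t.inner_vsub_circumcenter 0 1
  have h₁₂ := t.inner_vsub_circumcenter 1 2
  have h₂₀ := t.inner_vsub_circumcenter 2 0
  rw [← hD] at hR hH
  simp only [dist_comm (t.points 0) (t.points 2), dist_self] at *
  rw [← sq_eq_sq₀ dist_nonneg (by linarith), dist_eq_norm_vsub V,
    ← vsub_sub_vsub_cancel_right _ _ t.circumcenter, hN, Fin.sum_univ_three]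
  generalize dist (t.points 1) (t.points 2) = x at *
  generalize dist (t.points 2) (t.points 0) = y at *
  generalize dist (t.points 0) (t.points 1) = z at *
  generalize t.points 0 -ᵥ t.circumcenter = a at *
  generalize t.points 1 -ᵥ t.circumcenter = b at *
  generalize t.points 2 -ᵥ t.circumcenter = c at *
  generalize t.incenter -ᵥ t.circumcenter = d at *
  -- With O as origin, N = (a + b + c)/2; scaling by the perimeter clears the denominators of the
  -- incenter.
  have key : (x + y + z) • (d - (2⁻¹ : ℝ) • (a + b + c)) =
      ((x - y - z) / 2) • a + ((y - z - x) / 2) • b + ((z - x - y) / 2) • c := by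
    rw [smul_sub, hI]
    module
  have key' := congrArg (fun v ↦ ‖v‖ ^ 2) key
  simp only [norm_smul, mul_pow, Real.norm_eq_abs, sq_abs] at key'
  refine mul_left_cancel₀ (pow_ne_zero 2 hpos.ne') ?_
  rw [key', ← real_inner_self_eq_norm_sq]
  simp only [inner_add_left, inner_add_right, inner_smul_left, inner_smul_right, conj_trivial,
    real_inner_comm a b, real_inner_comm b c, real_inner_comm c a, h₀₀, h₁₁, h₂₂]
  simp only [h₀₁, h₁₂, h₂₀]
  linear_combination (x + y + z) / 2 * hR - hH / 4

end Affine.Triangle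

namespace FeuerbachTriangle

open EuclideanGeometry Affine

/-! ### The reflected triangles and their common tangent circles -/

theorem reflectedTriangle_eq_map (t : Triangle ℝ Plane) (i : Fin 3) :
    reflectedTriangle t i = (t.reindex (Equiv.swap (i + 1) (i + 2))).map
      (AffineIsometryEquiv.pointReflection ℝ
        (midpoint ℝ (t.points (i + 1)) (t.points (i + 2)))).toAffineIsometry.toAffineMap
      (AffineIsometryEquiv.pointReflection ℝ
        (midpoint ℝ (t.points (i + 1)) (t.points (i + 2)))).toAffineIsometry.injective := by
  ext1 j
  exact congrFun (update_reflectedVertex t i) j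

theorem pointReflection_midpoint_points (t : Triangle ℝ Plane) (i : Fin 3) (x : Plane) :
    AffineIsometryEquiv.pointReflection ℝ
      (midpoint ℝ (t.points (i + 1)) (t.points (i + 2))) x = ∑ j, t.points j - t.points i - x := by
  have hsum : ∑ j, t.points j = t.points i + t.points (i + 1) + t.points (i + 2) := by
    rw [Fin.sum_univ_three]
    fin_cases i <;> simp <;> abel
  rw [AffineIsometryEquiv.pointReflection_apply, midpoint_eq_smul_add, invOf_eq_inv, hsum, vsub_eq_sub,
    vadd_eq_add]
  module

theorem insphere_reflectedTriangle (t : Triangle ℝ Plane) (i : Fin 3) :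
    (reflectedTriangle t i).insphere =
      ⟨∑ j, t.points j - t.points i - t.incenter, t.inradius⟩ := by
  rw [reflectedTriangle_eq_map]
  ext1
  · rw [Simplex.insphere_center, Simplex.incenter_map, Simplex.incenter_reindex]
    exact pointReflection_midpoint_points t i _
  · rw [Simplex.insphere_radius, Simplex.inradius_map, Simplex.inradius_reindex]

theorem ninePointCircle_reflectedTriangle (t : Triangle ℝ Plane) (i : Fin 3) :
    (reflectedTriangle t i).ninePointCircle =
      ⟨∑ j, t.points j - t.points i - t.ninePointCircle.center, t.circumradius / 2⟩ := by
  rw [reflectedTriangle_eq_map, Simplex.ninePointCircle_map, Simplex.ninePointCircle_reindex]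
  ext1
  · exact pointReflection_midpoint_points t i _
  · simp [Simplex.ninePointCircle_radius]

theorem internallyTangent_iff_dist_center {s₁ s₂ : Sphere Plane} :
    InternallyTangent s₁ s₂ ↔
      dist s₁.center s₂.center = |s₁.radius - s₂.radius| ∧ 0 ≤ s₁.radius ∧ 0 ≤ s₂.radius := by
  rw [InternallyTangent, Sphere.isIntTangent_iff_dist_center, Sphere.isIntTangent_iff_dist_center,
    dist_comm s₂.center]
  constructor
  · rintro (⟨h, h₁, h₂⟩ | ⟨h, h₂, h₁⟩)
    · exact ⟨by rw [abs_sub_comm, ← h, abs_of_nonneg dist_nonneg], h₁, h₂⟩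
    · exact ⟨by rw [← h, abs_of_nonneg dist_nonneg], h₁, h₂⟩
  · rintro ⟨h, h₁, h₂⟩
    rcases abs_choice (s₁.radius - s₂.radius) with ha | ha
    · exact .inr ⟨h.trans ha, h₂, h₁⟩
    · exact .inl ⟨by rw [h, ha, neg_sub], h₁, h₂⟩

/-- If three circles of the same radius, at most the circumradius of `t`, have the reflected
vertices `q - t.points i` as their centers, then exactly one circle is internally tangent to all of
them. -/
theorem isCircleIntTangentTo_iff (t : Triangle ℝ Plane) {q : Plane} {r : ℝ} (hr : 0 ≤ r)
    (hle : r ≤ t.circumradius) {c : Fin 3 → Sphere Plane} (hc : ∀ i, c i = ⟨q - t.points i, r⟩)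
    {s : Sphere Plane} :
    IsCircleIntTangentTo s c ↔ s = ⟨q - t.circumcenter, t.circumradius + r⟩ := by
  have hdist : ∀ i, dist s.center (q - t.points i) = dist (t.points i) (q - s.center) := fun i ↦ by
    rw [dist_eq_norm, dist_eq_norm]
    congr 1
    abel
  simp only [IsCircleIntTangentTo, internallyTangent_iff_dist_center, hc, hdist]
  constructor
  · rintro ⟨hs, h⟩
    have hspan : q - s.center ∈ affineSpan ℝ (Set.range t.points) := by
      rw [t.independent.affineSpan_eq_top_iff_card_eq_finrank_add_one.2 (by simp)]
      exact AffineSubspace.mem_top _ _ _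
    have hcenter := t.eq_circumcenter_of_dist_eq hspan fun i ↦ (h i).1
    have hradius := t.eq_circumradius_of_dist_eq hspan fun i ↦ (h i).1
    ext1
    · rw [← hcenter, sub_sub_cancel]
    -- The second sign would give radius `r - t.circumradius ≤ 0`; this is where `hle` is needed.
    · rcases abs_choice (s.radius - r) with ha | ha
      · linarith
      · linarith
  · rintro rfl
    have hR := t.circumradius_pos
    refine ⟨by positivity, fun i ↦ ⟨?_, by positivity, hr⟩⟩
    rw [sub_sub_cancel, Simplex.dist_circumcenter_eq_circumradius, add_sub_cancel_right,
      abs_of_pos hR]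

theorem isCircleIntTangentTo_insphere_iff (t : Triangle ℝ Plane) {s : Sphere Plane} :
    IsCircleIntTangentTo s (fun i ↦ (reflectedTriangle t i).insphere) ↔
      s = ⟨∑ j, t.points j - t.incenter - t.circumcenter, t.circumradius + t.inradius⟩ :=
  isCircleIntTangentTo_iff t t.inradius_pos.le
    (by linarith [t.two_mul_inradius_le_circumradius, t.inradius_pos])
    fun i ↦ by rw [insphere_reflectedTriangle, sub_right_comm]

theorem isCircleIntTangentTo_ninePointCircle_iff (t : Triangle ℝ Plane) {s : Sphere Plane} :
    IsCircleIntTangentTo s (fun i ↦ (reflectedTriangle t i).ninePointCircle) ↔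
      s = ⟨∑ j, t.points j - t.ninePointCircle.center - t.circumcenter,
        t.circumradius + t.circumradius / 2⟩ :=
  isCircleIntTangentTo_iff t (half_pos t.circumradius_pos).le (half_le_self t.circumradius_pos.le)
    fun i ↦ by rw [ninePointCircle_reflectedTriangle, sub_right_comm]

end FeuerbachTriangle

theorem mainTheorem9 (t : Affine.Triangle ℝ Plane) :
    (∃! ω : EuclideanGeometry.Sphere Plane, FeuerbachTriangle.IsCircleIntTangentTo ω
      (fun i => (FeuerbachTriangle.reflectedTriangle t i).insphere)) ∧
    (∃! π : EuclideanGeometry.Sphere Plane, FeuerbachTriangle.IsCircleIntTangentTo π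
      (fun i => (FeuerbachTriangle.reflectedTriangle t i).ninePointCircle)) ∧
    ∀ ω π : EuclideanGeometry.Sphere Plane,
      FeuerbachTriangle.IsCircleIntTangentTo ω
        (fun i => (FeuerbachTriangle.reflectedTriangle t i).insphere) →
      FeuerbachTriangle.IsCircleIntTangentTo π
        (fun i => (FeuerbachTriangle.reflectedTriangle t i).ninePointCircle) →
      FeuerbachTriangle.TangentCircles ω π ∧ (ω = π → t.Equilateral) := by
  simp only [FeuerbachTriangle.isCircleIntTangentTo_insphere_iff,
    FeuerbachTriangle.isCircleIntTangentTo_ninePointCircle_iff]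
  refine ⟨existsUnique_eq, existsUnique_eq, ?_⟩
  rintro _ _ rfl rfl
  have hR := t.circumradius_pos
  have hr := t.inradius_pos
  -- ω is the inner circle, since R + r ≤ 3R/2.
  refine ⟨.inr (.inl (EuclideanGeometry.Sphere.isIntTangent_iff_dist_center.2
    ⟨?_, by positivity, by positivity⟩)), fun h ↦ ?_⟩
  · rw [dist_sub_right, dist_sub_left, t.dist_incenter_ninePointCircle_center]
    ring
  · have hradius := congrArg EuclideanGeometry.Sphere.radius h
    exact t.equilateral_of_circumradius_eq_two_mul_inradius (by simp at hradius; linarith)
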